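/- Let $d\ge 0$ be an integer and let $G$ be a countable, not necessarily connected graph in which every vertex has degree at most $d$. Write $d_G$ for the shortest path metric ($d_G(x,y)=\infty$ if $x,y$ lie in different components) and $B^G_r(x)=\{y : d_G(x,y)\le r\}$. For a finite set $F\subset V(G)$ let $\partial(F)$ be the set of vertices of $F$ that are adjacent to a vertex outside $F$. For $\varepsilon>0$, a nonempty finite set $F$ is $\varepsilon$-Følner if $|\partial(F)|/|F|<\varepsilon$. An $(\varepsilon,r)$-Følner packing is a family of pairwise disjoint $\varepsilon$-Følner sets of diameter (with respect to $d_G$) at most $r$; it is a tiling if its members cover $V(G)$. The set $P_G(\varepsilon,r)$ of these packings carries the topology induced from the product space $\{0,1\}^{\mathcal F}$, where $\mathcal F$ is the set of finite subsets of $V(G)$ and a packing is identified with the indicator function of the family of its members. Suppose that $G$ is of subexponential growth, that is, $$\lim_{r\to\infty}\ \sup_{x\in V(G)}\frac{\ln |B^G_r(x)|}{r}=0 .$$ Then $G$ is strongly almost finite: for every $\varepsilon>0$ there exist an integer $r\ge 1$ and a Borel probability measure $\nu$ on $P_G(\varepsilon,r)$ that is concentrated on tilings and such that, for every $x\in V(G)$,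 the $\nu$-measure of the set of tilings for which $x$ lies on the boundary $\partial(T)$ of the tile $T$ containing $x$ is less than $\varepsilon$. -/

import Mathlib

open MeasureTheory Filter Topology

namespace GraphTiling

variable {V : Type*}

/-- All vertex degrees of `G` are at most `d`. -/
def DegreeBoundedBy (G : SimpleGraph V) (d : ℕ) : Prop :=
  ∀ x : V, (G.neighborSet x).encard ≤ d

/-- The ball of radius `r` around `x` for the shortest path metric. The extended distance is
infinite between different connected components, so the ball stays in the component of `x`. -/
def graphBall (G : SimpleGraph V) (r : ℕ) (x : V) : Set V :=
  {y | G.edist x y ≤ r}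

/-- Uniform subexponential growth: `sup_x log |B_r(x)| / r → 0` as `r → ∞`.
In a graph whose degrees are at most `d` one has `1 ≤ |B_r(x)| ≤ (d + 1) ^ r`, so all balls are
finite and the suprema are over bounded families. -/
def SubexponentialGrowth (G : SimpleGraph V) : Prop :=
  Tendsto (fun r : ℕ => ⨆ x : V, Real.log ((graphBall G r x).ncard : ℝ) / (r : ℝ))
    atTop (𝓝 0)

/-- The vertices of `F` that are adjacent to a vertex outside `F`. -/
def innerBoundary (G : SimpleGraph V) (F : Finset V) : Set V :=
  {x | x ∈ F ∧ ∃ y, y ∉ F ∧ G.Adj x y}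

/-- `F` is a nonempty finite set with `|∂F| / |F| < ε`. -/
def IsFolnerSet (G : SimpleGraph V) (ε : ℝ) (F : Finset V) : Prop :=
  F.Nonempty ∧ ((innerBoundary G F).ncard : ℝ) / (F.card : ℝ) < ε

/-- The diameter of `F`, in the shortest path metric of the whole graph `G`, is at most `r`. -/
def DiamAtMost (G : SimpleGraph V) (r : ℕ) (F : Finset V) : Prop :=
  ∀ x ∈ F, ∀ y ∈ F, G.edist x y ≤ r

/-- An `(ε, r)`-packing: a family of pairwise disjoint `ε`-Følner sets of diameter at most `r`. -/
structure FolnerPacking (G : SimpleGraph V) (ε : ℝ) (r : ℕ) where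
  /-- The members of the packing. -/
  tiles : Set (Finset V)
  folner : ∀ F ∈ tiles, IsFolnerSet G ε F
  diam_le : ∀ F ∈ tiles, DiamAtMost G r F
  disjoint : ∀ F ∈ tiles, ∀ H ∈ tiles, F ≠ H → Disjoint F H

namespace FolnerPacking

variable {G : SimpleGraph V} {ε : ℝ} {r : ℕ}

/-- The packing is a tiling: its members cover all vertices. -/
def IsTiling (P : FolnerPacking G ε r) : Prop :=
  ∀ x : V, ∃ F ∈ P.tiles, x ∈ F

open Classical in
/-- The `0`-`1` coordinates of a packing: which finite sets belong to it. -/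
noncomputable def code (P : FolnerPacking G ε r) : Finset V → Bool :=
  fun F => decide (F ∈ P.tiles)

/-- The topology on packings: two packings are close if they agree on a large finite part of the
graph. It is induced by the product of discrete two-point spaces. -/
noncomputable instance : TopologicalSpace (FolnerPacking G ε r) :=
  TopologicalSpace.induced code inferInstance

/-- Measures on the space of packings are Borel measures. -/
noncomputable instance : MeasurableSpace (FolnerPacking G ε r) :=
  borel (FolnerPacking G ε r)

end FolnerPacking

/-- `G` is strongly almost finite: for every `ε > 0` there is an `r ≥ 1` and a Borel probability
measure on the space of `(ε, r)`-packings that is concentrated on tilings and for which every vertex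
lies on the boundary of the tile containing it with probability less than `ε`. -/
def StronglyAlmostFinite (G : SimpleGraph V) : Prop :=
  ∀ ε : ℝ, 0 < ε → ∃ r : ℕ, 1 ≤ r ∧
    ∃ ν : Measure (FolnerPacking G ε r), IsProbabilityMeasure ν ∧
      (∀ᵐ P ∂ν, P.IsTiling) ∧
      ∀ x : V, ν {P | P.IsTiling ∧ ∃ F ∈ P.tiles, x ∈ innerBoundary G F} < ENNReal.ofReal ε

end GraphTiling

namespace GraphTiling

/-! Two properties are required: every tile of every outcome is Følner, and every vertex is rarely
on a boundary. They are obtained from two different partitions.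

A deterministic partition into Følner clusters of bounded diameter comes from greedy ball carving.
Subexponential growth lets each ball stop at a radius where its next shell is relatively small, so
few vertices lie on cluster boundaries, at the scale of bounded neighbourhoods
(`SlowGrowth.exists_ball_carving`). A Markov argument shows that clusters with large boundary are
sparse. Since every finite set has a bounded neighbourhood on which growth at most doubles, Hall's
theorem absorbs the points of these bad clusters injectively into small reserved parts of good ones
(`SlowGrowth.exists_absorption`, `SlowGrowth.exists_folner_labels`).

Contracting the clusters gives a graph that still grows slowly. It is partitioned at random by balls
with truncated geometric radii (`SlowGrowth.exists_random_partition`): near-memorylessness makes it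
unlikely that the first ball to come near a vertex fails to swallow its whole unit ball. One radius
per colour of a finite colouring suffices, so there are finitely many outcomes.

Pulled back to the original graph, the random tiles are unions of Følner clusters, hence Følner in
every outcome, and a vertex is on a boundary only if its cluster has a neighbour in another part. -/

/-- A function may be chosen by recursion along a well-founded relation. -/
theorem exists_forall_of_wellFounded {W α : Type*} {lt : W → W → Prop} (hlt : WellFounded lt)
    (P : ∀ v : W, (∀ u, lt u v → α) → α → Prop) (h : ∀ v f, ∃ a, P v f a) :
    ∃ f : W → α, ∀ v, P v (fun u _ => f u) (f v) := by
  choose g hg using h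
  refine ⟨hlt.fix g, fun v => ?_⟩
  rw [WellFounded.fix_eq]
  exact hg _ _

/-! ### Ball growth and neighbourhoods of finite sets. -/

section Growth

variable {V : Type*} {G : SimpleGraph V}

theorem edist_le_add {x y z : V} {a b : ℕ} (h₁ : G.edist x y ≤ a) (h₂ : G.edist y z ≤ b) :
    G.edist x z ≤ ((a + b : ℕ) : ℕ∞) := by
  push_cast
  exact G.edist_triangle.trans (add_le_add h₁ h₂)

theorem edist_le_symm {x y : V} {a : ℕ∞} (h : G.edist x y ≤ a) : G.edist y x ≤ a := by
  rwa [SimpleGraph.edist_comm]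

theorem edist_le_mono {x y : V} {a b : ℕ} (h : G.edist x y ≤ a) (hab : a ≤ b) :
    G.edist x y ≤ b :=
  h.trans (by exact_mod_cast hab)

theorem edist_self_le (x : V) (a : ℕ) : G.edist x x ≤ a := by
  simp

theorem edist_le_one_of_adj {x y : V} (h : G.Adj x y) : G.edist x y ≤ (1 : ℕ) := by
  have := SimpleGraph.edist_le_one_iff_adj_or_eq.2 (Or.inl h)
  exact_mod_cast this

/-- Distances in a graph are realised by walks, so a point at distance at most `r + 1` has a
predecessor at distance at most `r`. -/
theorem exists_edist_le_of_le_succ {x z : V} {r : ℕ} (h : G.edist x z ≤ ((r + 1 : ℕ) : ℕ∞)) :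
    ∃ y, G.edist x y ≤ r ∧ (y = z ∨ G.Adj y z) := by
  have hne : G.edist z x ≠ ⊤ := by
    rw [SimpleGraph.edist_comm]
    exact ne_top_of_le_ne_top (ENat.natCast_ne_top _) h
  obtain ⟨p, hp⟩ := SimpleGraph.exists_walk_of_edist_ne_top hne
  rw [SimpleGraph.edist_comm, ← hp] at h
  cases p with
  | nil => exact ⟨x, edist_self_le _ _, Or.inl rfl⟩
  | cons hadj q =>
    refine ⟨_, ?_, Or.inr hadj.symm⟩
    rw [SimpleGraph.edist_comm]
    refine (SimpleGraph.edist_le q).trans ?_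
    have h' : q.length + 1 ≤ r + 1 := by exact_mod_cast h
    exact_mod_cast Nat.le_of_succ_le_succ h'

/-- A function that expands distances of adjacent vertices by at most `L` expands all distances by
at most `L`. -/
theorem edist_le_mul_of_adj {H : SimpleGraph V} {L : ℕ}
    (hL : ∀ x y, H.Adj x y → G.edist x y ≤ L) (n : ℕ) :
    ∀ x y, H.edist x y ≤ n → G.edist x y ≤ ((L * n : ℕ) : ℕ∞) := by
  induction n with
  | zero =>
    intro x y h
    have : x = y := by simpa using h
    subst this
    simp
  | succ n ih =>
    intro x y h
    obtain ⟨z, hz, rfl | hzy⟩ := exists_edist_le_of_le_succ h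
    · exact edist_le_mono (ih _ _ hz) (by gcongr; omega)
    · exact edist_le_mono (edist_le_add (ih _ _ hz) (hL _ _ hzy)) (by rw [Nat.mul_succ])

/-- A set closed under adjacency is a union of components. This later rules out absorption into a
cluster with empty boundary. -/
theorem mem_of_edist_le {S : Set V} (hS : ∀ x ∈ S, ∀ y, G.Adj x y → y ∈ S) {x : V} (hx : x ∈ S)
    (r : ℕ) : ∀ y, G.edist x y ≤ r → y ∈ S := by
  induction r with
  | zero =>
    intro y h
    have : x = y := by simpa using h
    exact this ▸ hx
  | succ r ih =>
    intro y h
    obtain ⟨z, hz, rfl | hzy⟩ := exists_edist_le_of_le_succ h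
    · exact ih _ hz
    · exact hS z (ih _ hz) _ hzy

theorem encard_graphBall_le {d : ℕ} (hd : DegreeBoundedBy G d) (r : ℕ) (x : V) :
    (graphBall G r x).encard ≤ (((d + 1) ^ r : ℕ) : ℕ∞) := by
  induction r with
  | zero =>
    have : graphBall G 0 x ⊆ {x} := by
      intro y hy
      simpa [graphBall] using hy
    simpa using Set.encard_le_encard this
  | succ r ih =>
    have hfin : (graphBall G r x).Finite := Set.finite_of_encard_le_coe ih
    have hsub : graphBall G (r + 1) x ⊆
        ⋃ y ∈ hfin.toFinset, insert y (G.neighborSet y) := by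
      intro z hz
      obtain ⟨y, hy, h⟩ := exists_edist_le_of_le_succ (G := G) (x := x) (z := z) (r := r) hz
      simp only [Set.mem_iUnion]
      refine ⟨y, hfin.mem_toFinset.2 hy, ?_⟩
      rcases h with rfl | h
      · exact Set.mem_insert _ _
      · exact Set.mem_insert_of_mem _ h
    have hcard : ∀ s : Finset V, (⋃ y ∈ s, insert y (G.neighborSet y)).encard ≤
        ((s.card * (d + 1) : ℕ) : ℕ∞) := by
      classical
      intro s
      induction s using Finset.induction_on with
      | empty => simp
      | insert a s ha ih =>
        rw [Finset.set_biUnion_insert, Finset.card_insert_of_notMem ha]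
        refine (Set.encard_union_le _ _).trans ?_
        have h1 : (insert a (G.neighborSet a)).encard ≤ ((d + 1 : ℕ) : ℕ∞) := by
          refine (Set.encard_insert_le _ _).trans ?_
          push_cast
          gcongr
          exact hd a
        refine (add_le_add h1 ih).trans (le_of_eq ?_)
        norm_cast
        ring
    refine (Set.encard_le_encard hsub).trans ((hcard _).trans ?_)
    have h2 : hfin.toFinset.card ≤ (d + 1) ^ r := by
      rw [hfin.encard_eq_coe_toFinset_card] at ih
      exact_mod_cast ih
    rw [pow_succ]
    exact_mod_cast Nat.mul_le_mul_right _ h2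

/-- All balls of finite radius are finite. -/
def FiniteBalls (G : SimpleGraph V) : Prop :=
  ∀ (r : ℕ) (x : V), (graphBall G r x).Finite

/-- Balls grow more slowly than every exponential, uniformly in the centre. -/
def SlowGrowth (G : SimpleGraph V) : Prop :=
  ∀ b : ℝ, 1 < b → ∃ N : ℕ, ∀ r ≥ N, ∀ x : V, ((graphBall G r x).ncard : ℝ) ≤ b ^ r

theorem DegreeBoundedBy.finiteBalls {d : ℕ} (hd : DegreeBoundedBy G d) : FiniteBalls G :=
  fun r x => Set.finite_of_encard_le_coe (encard_graphBall_le hd r x)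

theorem DegreeBoundedBy.ncard_graphBall_le {d : ℕ} (hd : DegreeBoundedBy G d) (r : ℕ) (x : V) :
    (graphBall G r x).ncard ≤ (d + 1) ^ r := by
  have h := encard_graphBall_le hd r x
  rw [← (hd.finiteBalls r x).cast_ncard_eq] at h
  exact_mod_cast h

theorem FiniteBalls.ncard_pos (hfin : FiniteBalls G) (r : ℕ) (x : V) :
    0 < (graphBall G r x).ncard :=
  (Set.ncard_pos (hfin r x)).2 ⟨x, edist_self_le x r⟩

theorem SubexponentialGrowth.slowGrowth {d : ℕ} (hd : DegreeBoundedBy G d)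
    (hG : SubexponentialGrowth G) : SlowGrowth G := by
  intro b hb
  have hlog : 0 < Real.log b := Real.log_pos hb
  obtain ⟨N, hN⟩ := eventually_atTop.1 (hG.eventually (gt_mem_nhds hlog))
  refine ⟨max N 1, fun r hr x => ?_⟩
  have hr0 : (0 : ℝ) < r := by
    have : 0 < r := lt_of_lt_of_le one_pos ((le_max_right N 1).trans hr)
    exact_mod_cast this
  have hpos : ∀ y, (0 : ℝ) < (graphBall G r y).ncard := fun y => by
    exact_mod_cast hd.finiteBalls.ncard_pos r y
  -- A real supremum bounds its terms only when the family is bounded; the degree bound supplies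
  -- this.
  have hbdd : BddAbove (Set.range fun y : V =>
      Real.log ((graphBall G r y).ncard : ℝ) / (r : ℝ)) := by
    refine ⟨Real.log (((d + 1) ^ r : ℕ) : ℝ) / r, ?_⟩
    rintro _ ⟨y, rfl⟩
    have : ((graphBall G r y).ncard : ℝ) ≤ (((d + 1) ^ r : ℕ) : ℝ) := by
      exact_mod_cast hd.ncard_graphBall_le r y
    dsimp only
    gcongr
    exact hpos y
  have h := (le_ciSup hbdd x).trans_lt (hN r ((le_max_left _ _).trans hr))
  rw [div_lt_iff₀ hr0, mul_comm, ← Real.log_pow] at h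
  exact ((Real.log_lt_log_iff (hpos x) (by positivity)).1 h).le

/-- The ball of radius `r` around `x` as a finite set. -/
noncomputable def FiniteBalls.ball (hfin : FiniteBalls G) (r : ℕ) (x : V) : Finset V :=
  (hfin r x).toFinset

@[simp] theorem FiniteBalls.mem_ball (hfin : FiniteBalls G) {r : ℕ} {x y : V} :
    y ∈ hfin.ball r x ↔ G.edist x y ≤ r := by
  simp [FiniteBalls.ball, graphBall]

theorem FiniteBalls.card_ball (hfin : FiniteBalls G) (r : ℕ) (x : V) :
    (hfin.ball r x).card = (graphBall G r x).ncard :=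
  (Set.ncard_eq_toFinset_card _ (hfin r x)).symm

variable [DecidableEq V]

/-- The closed `r`-neighbourhood of a finite set. -/
noncomputable def FiniteBalls.nbhd (hfin : FiniteBalls G) (r : ℕ) (F : Finset V) : Finset V :=
  F.biUnion (hfin.ball r)

@[simp] theorem FiniteBalls.mem_nbhd (hfin : FiniteBalls G) {r : ℕ} {F : Finset V} {y : V} :
    y ∈ hfin.nbhd r F ↔ ∃ x ∈ F, G.edist x y ≤ r := by
  simp [FiniteBalls.nbhd]

theorem FiniteBalls.nbhd_nbhd_subset (hfin : FiniteBalls G) (r s : ℕ) (F : Finset V) :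
    hfin.nbhd s (hfin.nbhd r F) ⊆ hfin.nbhd (r + s) F := by
  intro y hy
  simp only [FiniteBalls.mem_nbhd] at hy ⊢
  obtain ⟨x, ⟨z, hz, hzx⟩, hxy⟩ := hy
  exact ⟨z, hz, edist_le_add hzx hxy⟩

theorem FiniteBalls.nbhd_mono (hfin : FiniteBalls G) {r s : ℕ} (hrs : r ≤ s) (F : Finset V) :
    hfin.nbhd r F ⊆ hfin.nbhd s F := by
  intro y hy
  simp only [FiniteBalls.mem_nbhd] at hy ⊢
  obtain ⟨x, hx, hxy⟩ := hy
  exact ⟨x, hx, edist_le_mono hxy hrs⟩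

/-- In a graph of slow growth every finite set has a neighbourhood of bounded radius that at most
doubles when it is enlarged by `s`. -/
theorem SlowGrowth.exists_nbhd_doubling (hG : SlowGrowth G) (hfin : FiniteBalls G) (s : ℕ) :
    ∃ K : ℕ, ∀ F : Finset V, ∃ k ≤ K,
      (hfin.nbhd (k + s) F).card ≤ 2 * (hfin.nbhd k F).card := by
  -- At this base, balls of radius `(N + 1) * (s + 1)` have at most `2 ^ (N + 1)` points, which
  -- contradicts `N + 1` strict doublings. Using `s + 1` also covers `s = 0` and makes the radius at
  -- least `N`.
  have hb : (1 : ℝ) < 2 ^ ((1 : ℝ) / (s + 1)) := Real.one_lt_rpow (by norm_num) (by positivity)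
  obtain ⟨N, hN⟩ := hG _ hb
  refine ⟨(N + 1) * s, fun F => ?_⟩
  by_contra! hcon
  rcases F.eq_empty_or_nonempty with rfl | hF
  · simpa [FiniteBalls.nbhd] using hcon 0 (Nat.zero_le _)
  have hgrow : ∀ j ≤ N, 2 ^ j * F.card ≤ (hfin.nbhd (j * s) F).card := by
    intro j hj
    induction j with
    | zero =>
      refine (by simp : 2 ^ 0 * F.card ≤ F.card).trans (Finset.card_le_card fun x hx => ?_)
      exact (hfin.mem_nbhd).2 ⟨x, hx, edist_self_le x _⟩
    | succ j ih =>
      have h1 := hcon (j * s) (Nat.mul_le_mul_right _ (by omega))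
      have h2 := ih (by omega)
      rw [show (j + 1) * s = j * s + s by ring, pow_succ]
      linarith
  have hlow : 2 ^ (N + 1) * F.card < (hfin.nbhd ((N + 1) * (s + 1)) F).card := by
    have h1 := hcon (N * s) (Nat.mul_le_mul_right _ (by omega))
    have h2 := hgrow N le_rfl
    have h3 := Finset.card_le_card
      (hfin.nbhd_mono (show N * s + s ≤ (N + 1) * (s + 1) by nlinarith) F)
    rw [pow_succ]
    linarith
  have hpow : ((2 : ℝ) ^ ((1 : ℝ) / (s + 1))) ^ ((N + 1) * (s + 1)) = 2 ^ (N + 1) := by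
    rw [mul_comm, pow_mul, ← Real.rpow_natCast _ (s + 1), ← Real.rpow_mul (by norm_num)]
    congr 1
    push_cast
    rw [one_div_mul_cancel (by positivity), Real.rpow_one]
  have hup : (hfin.nbhd ((N + 1) * (s + 1)) F).card ≤ F.card * 2 ^ (N + 1) := by
    refine Finset.card_biUnion_le_card_mul _ _ _ fun x _ => ?_
    have h := hN ((N + 1) * (s + 1)) (by nlinarith) x
    rw [hpow, ← hfin.card_ball] at h
    exact_mod_cast h
  linarith

end Growth
end GraphTiling

namespace GraphTiling

/-! ### Greedy ball carving. -/

section Carving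

variable {V : Type*} {G : SimpleGraph V}

open Classical in
/-- The points of `A` at distance less than `r` from `v`. -/
noncomputable def FiniteBalls.openBallIn (hfin : FiniteBalls G) (A : Set V) (r : ℕ) (v : V) :
    Finset V :=
  (hfin.ball r v).filter fun x => G.edist v x < r ∧ x ∈ A

@[simp] theorem FiniteBalls.mem_openBallIn (hfin : FiniteBalls G) {A : Set V} {r : ℕ} {v x : V} :
    x ∈ hfin.openBallIn A r v ↔ G.edist v x < r ∧ x ∈ A := by
  simp only [FiniteBalls.openBallIn, Finset.mem_filter, FiniteBalls.mem_ball]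
  exact ⟨fun h => h.2, fun h => ⟨h.1.le, h⟩⟩

theorem edist_lt_succ_iff {x y : V} {r : ℕ} :
    G.edist x y < ((r + 1 : ℕ) : ℕ∞) ↔ G.edist x y ≤ r := by
  push_cast
  exact ENat.lt_add_one_iff (ENat.natCast_ne_top r)

/-- Growth by more than `1 + δ` at every radius up to `R` would compound to more points than a ball
of radius `R` has. Open balls of radius `0` are empty, so radius `0` qualifies only if `v ∉ A`. -/
theorem FiniteBalls.exists_slow_radius (hfin : FiniteBalls G) {δ : ℝ} (hδ : 0 < δ) {R : ℕ}
    (hR : ∀ x, ((graphBall G R x).ncard : ℝ) < (1 + δ) ^ R) (A : Set V) (v : V) :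
    ∃ r ≤ R, ((hfin.openBallIn A (r + 1) v).card : ℝ) ≤
      (1 + δ) * (hfin.openBallIn A r v).card := by
  by_contra! hcon
  have hgrow : ∀ j ≤ R, (1 + δ) ^ j ≤ ((hfin.openBallIn A (j + 1) v).card : ℝ) := by
    intro j hj
    induction j with
    | zero =>
      have h := hcon 0 (Nat.zero_le _)
      have h' : (0 : ℝ) < (hfin.openBallIn A 1 v).card := lt_of_le_of_lt (by positivity) h
      have : 1 ≤ (hfin.openBallIn A 1 v).card := by exact_mod_cast h'
      simpa using this
    | succ j ih =>
      have h1 := ih (by omega)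
      have h2 := hcon (j + 1) hj
      rw [pow_succ, mul_comm]
      exact (mul_le_mul_of_nonneg_left h1 (by positivity)).trans h2.le
  have h1 := hgrow R le_rfl
  have h2 : (hfin.openBallIn A (R + 1) v).card ≤ (graphBall G R v).ncard := by
    rw [← hfin.card_ball]
    refine Finset.card_le_card fun x hx => ?_
    rw [hfin.mem_openBallIn, edist_lt_succ_iff] at hx
    exact hfin.mem_ball.2 hx.1
  have h3 : ((hfin.openBallIn A (R + 1) v).card : ℝ) ≤ (graphBall G R v).ncard := by
    exact_mod_cast h2
  linarith [hR v]

open Classical in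
/-- The cluster with label `u` of a labelling that moves points by at most `R`. -/
noncomputable def FiniteBalls.cluster (hfin : FiniteBalls G) (R : ℕ) (c : V → V) (u : V) :
    Finset V :=
  (hfin.ball R u).filter fun x => c x = u

theorem FiniteBalls.mem_cluster (hfin : FiniteBalls G) {R : ℕ} {c : V → V}
    (hc : ∀ x, G.edist (c x) x ≤ R) {u x : V} : x ∈ hfin.cluster R c u ↔ c x = u := by
  simp only [FiniteBalls.cluster, Finset.mem_filter, FiniteBalls.mem_ball]
  exact ⟨fun h => h.2, fun h => ⟨h ▸ hc x, h⟩⟩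

/-- Greedy ball carving: a partition into clusters of bounded diameter such that every edge between
two clusters ends in a small set attached to one of them. -/
theorem SlowGrowth.exists_ball_carving (hG : SlowGrowth G) (hfin : FiniteBalls G) {δ : ℝ}
    (hδ : 0 < δ) :
    ∃ (R : ℕ) (c : V → V) (O : V → Finset V),
      (∀ x, G.edist (c x) x ≤ R) ∧ (∀ u, ∀ y ∈ O u, G.edist u y ≤ R) ∧
      (∀ u, ((O u).card : ℝ) ≤ δ * (hfin.cluster R c u).card) ∧
      ∀ x y, G.Adj x y → c x ≠ c y → y ∈ O (c x) ∨ x ∈ O (c y) := by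
  classical
  obtain ⟨N, hN⟩ := hG (1 + δ / 2) (by linarith)
  obtain ⟨R, hRN, hR1⟩ : ∃ R, N ≤ R ∧ 1 ≤ R := ⟨max N 1, le_max_left _ _, le_max_right _ _⟩
  have hR : ∀ x, ((graphBall G R x).ncard : ℝ) < (1 + δ) ^ R := fun x =>
    (hN R hRN x).trans_lt (pow_lt_pow_left₀ (by linarith) (by positivity) (by omega))
  let lt : V → V → Prop := WellOrderingRel
  have hwf : WellFounded lt := IsWellFounded.wf
  have htrans : ∀ {a b c : V}, lt a b → lt b c → lt a c := fun h₁ h₂ =>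
    IsTrans.trans (r := WellOrderingRel) _ _ _ h₁ h₂
  have htri : ∀ a b : V, lt a b ∨ a = b ∨ lt b a := fun a b =>
    trichotomous_of WellOrderingRel a b
  -- The radius of `v` is chosen relative to the points missed by the open balls of all earlier
  -- centres.
  obtain ⟨ρ, hρ⟩ := exists_forall_of_wellFounded hwf
    (fun v (f : ∀ u, lt u v → ℕ) (r : ℕ) => r ≤ R ∧
      ((hfin.openBallIn {x | ∀ u (h : lt u v), ¬ G.edist u x < f u h} (r + 1) v).card : ℝ) ≤
      (1 + δ) * (hfin.openBallIn {x | ∀ u (h : lt u v), ¬ G.edist u x < f u h} r v).card)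
    (fun v f => hfin.exists_slow_radius hδ hR _ v)
  let A : V → Set V := fun v => {x | ∀ u, lt u v → ¬ G.edist u x < ρ u}
  have hA : ∀ v, ((hfin.openBallIn (A v) (ρ v + 1) v).card : ℝ) ≤
      (1 + δ) * (hfin.openBallIn (A v) (ρ v) v).card := fun v => (hρ v).2
  -- An uncaptured `x` would have radius `0` while still being available to itself, and radius `0`
  -- is then not slow.
  have hcov : ∀ x, ∃ v, G.edist v x < ρ v := by
    intro x
    by_contra! hcon
    have hx : x ∈ A x := fun u _ => not_lt.2 (hcon u)
    have h0 : ρ x = 0 := by simpa using hcon x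
    have h := hA x
    have he : hfin.openBallIn (A x) 0 x = ∅ := by
      ext y
      simp
    rw [h0, he, Finset.card_empty, Nat.cast_zero, mul_zero] at h
    have h1 : x ∈ hfin.openBallIn (A x) (0 + 1) x := by
      rw [hfin.mem_openBallIn, edist_lt_succ_iff]
      exact ⟨edist_self_le _ _, hx⟩
    have h2 : 0 < (hfin.openBallIn (A x) (0 + 1) x).card := Finset.card_pos.2 ⟨x, h1⟩
    have h3 : (0 : ℝ) < (hfin.openBallIn (A x) (0 + 1) x).card := by exact_mod_cast h2
    linarith
  have hmin : ∀ x, ∃ v, G.edist v x < ρ v ∧ x ∈ A v := fun x =>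
    ⟨hwf.min {v | G.edist v x < ρ v} (hcov x), hwf.min_mem _ (hcov x),
      fun u hu hux => hwf.not_lt_min {v | G.edist v x < ρ v} hux hu⟩
  choose c hc1 hc2 using hmin
  have hceq : ∀ x u, G.edist u x < ρ u → x ∈ A u → c x = u := by
    intro x u h1 h2
    rcases htri (c x) u with h | h | h
    · exact absurd (hc1 x) (h2 _ h)
    · exact h
    · exact absurd h1 (hc2 x _ h)
  have hcR : ∀ x, G.edist (c x) x ≤ R := fun x =>
    edist_le_mono (hc1 x).le (hρ (c x)).1
  refine ⟨R + 1, c, fun u => hfin.openBallIn (A u) (ρ u + 1) u \ hfin.openBallIn (A u) (ρ u) u,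
    fun x => edist_le_mono (hcR x) (by omega), ?_, ?_, ?_⟩
  · intro u y hy
    rw [Finset.mem_sdiff, hfin.mem_openBallIn] at hy
    exact edist_le_mono hy.1.1.le (by have := (hρ u).1; omega)
  · intro u
    have hsub : hfin.openBallIn (A u) (ρ u) u ⊆ hfin.openBallIn (A u) (ρ u + 1) u := by
      intro x hx
      rw [hfin.mem_openBallIn] at hx ⊢
      exact ⟨hx.1.trans (by exact_mod_cast Nat.lt_succ_self _), hx.2⟩
    have h1 : (hfin.openBallIn (A u) (ρ u) u).card ≤ (hfin.cluster (R + 1) c u).card := by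
      refine Finset.card_le_card fun x hx => ?_
      rw [hfin.mem_openBallIn] at hx
      rw [hfin.mem_cluster fun x => edist_le_mono (hcR x) (Nat.le_succ R)]
      exact hceq x u hx.1 hx.2
    have h2 : ((hfin.openBallIn (A u) (ρ u) u).card : ℝ) ≤ (hfin.cluster (R + 1) c u).card := by
      exact_mod_cast h1
    rw [Finset.card_sdiff_of_subset hsub, Nat.cast_sub (Finset.card_le_card hsub)]
    nlinarith [hA u]
  -- If `x` is captured first, then `y` was still available to the centre `c x`, lies within `ρ (c
  -- x)` of it, yet escaped its open ball: it is in the shell.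
  · have key : ∀ x y, G.Adj x y → lt (c x) (c y) →
        y ∈ hfin.openBallIn (A (c x)) (ρ (c x) + 1) (c x) \
          hfin.openBallIn (A (c x)) (ρ (c x)) (c x) := by
      intro x y hxy hlt
      have hyA : y ∈ A (c x) := fun u hu => hc2 y u (htrans hu hlt)
      rw [Finset.mem_sdiff, hfin.mem_openBallIn, hfin.mem_openBallIn]
      refine ⟨⟨?_, hyA⟩, fun h => hc2 y _ hlt h.1⟩
      have h1 : G.edist (c x) y ≤ G.edist (c x) x + 1 := by
        refine (G.edist_triangle (v := x)).trans ?_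
        gcongr
        exact (SimpleGraph.edist_eq_one_iff_adj.2 hxy).le
      refine h1.trans_lt ?_
      push_cast
      exact (ENat.add_lt_add_iff_right ENat.one_ne_top).2 (hc1 x)
    intro x y hxy hne
    rcases htri (c x) (c y) with h | h | h
    · exact Or.inl (key x y hxy h)
    · exact absurd h hne
    · exact Or.inr (key y x hxy.symm h)

end Carving
end GraphTiling

namespace GraphTiling

/-! ### A deterministic Følner partition, by Hall's theorem. -/

section FolnerLabels

variable {V : Type*} {G : SimpleGraph V}

open Classical in
/-- The inner boundary as a finite set. -/
noncomputable def boundaryFinset (G : SimpleGraph V) (F : Finset V) : Finset V :=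
  F.filter fun x => ∃ y, y ∉ F ∧ G.Adj x y

@[simp] theorem mem_boundaryFinset {F : Finset V} {x : V} :
    x ∈ boundaryFinset G F ↔ x ∈ F ∧ ∃ y, y ∉ F ∧ G.Adj x y := by
  simp [boundaryFinset]

theorem ncard_innerBoundary (F : Finset V) :
    (innerBoundary G F).ncard = (boundaryFinset G F).card := by
  rw [← Set.ncard_coe_finset]
  congr 1
  ext x
  simp [innerBoundary]

variable [DecidableEq V]

theorem FiniteBalls.sum_card_cluster (hfin : FiniteBalls G) {R : ℕ} {c : V → V}
    (S : V → Finset V) (hS : ∀ u, S u ⊆ hfin.cluster R c u) (U : Finset V) :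
    (U.biUnion S).card = ∑ u ∈ U, (S u).card := by
  refine Finset.card_biUnion fun u _ v _ huv => ?_
  refine Finset.disjoint_left.2 fun x hx hx' => ?_
  have h1 := hS u hx
  have h2 := hS v hx'
  simp only [FiniteBalls.cluster, Finset.mem_filter] at h1 h2
  exact huv (h1.2.symm.trans h2.2)

open Classical in
/-- In a carved partition the vertices on the boundary of their cluster are sparse. -/
theorem FiniteBalls.card_filter_boundary_le (hfin : FiniteBalls G) {D : ℕ}
    (hD : ∀ x, (hfin.ball 1 x).card ≤ D) {δ : ℝ} (hδ : 0 < δ) {R : ℕ} {c : V → V}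
    {O : V → Finset V} (hc : ∀ x, G.edist (c x) x ≤ R) (hO : ∀ u, ∀ y ∈ O u, G.edist u y ≤ R)
    (hcard : ∀ u, ((O u).card : ℝ) ≤ δ * (hfin.cluster R c u).card)
    (hadj : ∀ x y, G.Adj x y → c x ≠ c y → y ∈ O (c x) ∨ x ∈ O (c y)) (F : Finset V) :
    ((F.filter fun x => ∃ y, G.Adj x y ∧ c x ≠ c y).card : ℝ) ≤
      D * δ * (hfin.nbhd (2 * R + 1) F).card := by
  set U := hfin.nbhd (R + 1) F with hU
  have hsub : (F.filter fun x => ∃ y, G.Adj x y ∧ c x ≠ c y) ⊆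
      (U.biUnion O).biUnion (hfin.ball 1) := by
    intro x hx
    obtain ⟨hxF, y, hxy, hne⟩ := Finset.mem_filter.1 hx
    simp only [Finset.mem_biUnion, hU, FiniteBalls.mem_nbhd, FiniteBalls.mem_ball]
    rcases hadj x y hxy hne with h | h
    · refine ⟨y, ⟨c x, ⟨x, hxF, edist_le_mono (edist_le_symm (hc x)) (by omega)⟩, h⟩,
        edist_le_one_of_adj hxy.symm⟩
    · refine ⟨x, ⟨c y, ⟨x, hxF, ?_⟩, h⟩, edist_self_le _ _⟩
      exact edist_le_mono (edist_le_symm (hO _ _ h)) (by omega)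
  have h1 : (F.filter fun x => ∃ y, G.Adj x y ∧ c x ≠ c y).card ≤ (∑ u ∈ U, (O u).card) * D := by
    refine (Finset.card_le_card hsub).trans ?_
    refine (Finset.card_biUnion_le_card_mul _ _ D fun x _ => hD x).trans ?_
    exact Nat.mul_le_mul_right _ Finset.card_biUnion_le
  have h2 : (∑ u ∈ U, (hfin.cluster R c u).card) ≤ (hfin.nbhd (2 * R + 1) F).card := by
    rw [← hfin.sum_card_cluster _ (fun u => subset_rfl) U]
    refine Finset.card_le_card fun x hx => ?_
    obtain ⟨u, hu, hxu⟩ := Finset.mem_biUnion.1 hx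
    rw [hU, FiniteBalls.mem_nbhd] at hu
    obtain ⟨z, hz, hzu⟩ := hu
    rw [hfin.mem_cluster hc] at hxu
    refine hfin.mem_nbhd.2 ⟨z, hz, edist_le_mono (edist_le_add hzu (hxu ▸ hc x)) (by omega)⟩
  have h3 : (∑ u ∈ U, ((O u).card : ℝ)) ≤ δ * (hfin.nbhd (2 * R + 1) F).card := by
    refine (Finset.sum_le_sum fun u _ => hcard u).trans ?_
    rw [← Finset.mul_sum]
    gcongr
    exact_mod_cast h2
  have h1' : ((F.filter fun x => ∃ y, G.Adj x y ∧ c x ≠ c y).card : ℝ) ≤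
      (∑ u ∈ U, ((O u).card : ℝ)) * D := by exact_mod_cast h1
  refine h1'.trans ?_
  calc _ ≤ δ * (hfin.nbhd (2 * R + 1) F).card * (D : ℝ) := by gcongr
    _ = _ := by ring

open Classical in
/-- The vertices in clusters with a large boundary are sparse. -/
theorem FiniteBalls.card_filter_bad_le (hfin : FiniteBalls G) {R : ℕ} {c : V → V}
    (hc : ∀ x, G.edist (c x) x ≤ R) {κ η : ℝ} {s : ℕ} (hκ : 0 ≤ κ) (hη : 0 < η)
    (hbd : ∀ F : Finset V, ((F.filter fun x => ∃ y, G.Adj x y ∧ c x ≠ c y).card : ℝ) ≤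
      κ * (hfin.nbhd s F).card) (F : Finset V) :
    η * (F.filter fun x => η * (hfin.cluster R c (c x)).card <
      (boundaryFinset G (hfin.cluster R c (c x))).card).card ≤
      κ * (hfin.nbhd (2 * R + s) F).card := by
  set bad : V → Prop := fun u => η * (hfin.cluster R c u).card <
      (boundaryFinset G (hfin.cluster R c u)).card with hbad
  set U := (F.image c).filter bad with hU
  have h1 : (F.filter fun x => bad (c x)).card ≤ ∑ u ∈ U, (hfin.cluster R c u).card := by
    refine (Finset.card_le_card fun x hx => ?_).trans Finset.card_biUnion_le
    rw [Finset.mem_filter] at hx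
    refine Finset.mem_biUnion.2 ⟨c x, ?_, (hfin.mem_cluster hc).2 rfl⟩
    exact Finset.mem_filter.2 ⟨Finset.mem_image_of_mem c hx.1, hx.2⟩
  have h2 : ∑ u ∈ U, (boundaryFinset G (hfin.cluster R c u)).card ≤
      ((hfin.nbhd (2 * R) F).filter fun x => ∃ y, G.Adj x y ∧ c x ≠ c y).card := by
    rw [← hfin.sum_card_cluster (R := R) (c := c)
      (fun u => boundaryFinset G (hfin.cluster R c u)) (fun u => Finset.filter_subset _ _) U]
    refine Finset.card_le_card fun x hx => ?_
    obtain ⟨u, hu, hx⟩ := Finset.mem_biUnion.1 hx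
    obtain ⟨hxu, y, hy, hxy⟩ := mem_boundaryFinset.1 hx
    rw [hfin.mem_cluster hc] at hxu hy
    obtain ⟨z, hz, rfl⟩ := Finset.mem_image.1 (Finset.mem_filter.1 hu).1
    refine Finset.mem_filter.2 ⟨hfin.mem_nbhd.2 ⟨z, hz, ?_⟩, y, hxy, fun h => hy (h ▸ hxu)⟩
    exact edist_le_mono (edist_le_add (edist_le_symm (hc z)) (hxu ▸ hc x)) (by omega)
  have h3 : ((hfin.nbhd s (hfin.nbhd (2 * R) F)).card : ℝ) ≤
      (hfin.nbhd (2 * R + s) F).card := by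
    exact_mod_cast Finset.card_le_card (hfin.nbhd_nbhd_subset _ _ _)
  -- Markov's inequality: each bad cluster contributes boundary exceeding `η` times its size.
  calc η * (F.filter fun x => bad (c x)).card
      ≤ η * ∑ u ∈ U, ((hfin.cluster R c u).card : ℝ) := by
        gcongr
        exact_mod_cast h1
    _ = ∑ u ∈ U, η * ((hfin.cluster R c u).card : ℝ) := Finset.mul_sum _ _ _
    _ ≤ ∑ u ∈ U, ((boundaryFinset G (hfin.cluster R c u)).card : ℝ) :=
        Finset.sum_le_sum fun u hu => (Finset.mem_filter.1 hu).2.le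
    _ ≤ ((hfin.nbhd (2 * R) F).filter fun x => ∃ y, G.Adj x y ∧ c x ≠ c y).card := by
        exact_mod_cast h2
    _ ≤ κ * (hfin.nbhd s (hfin.nbhd (2 * R) F)).card := hbd _
    _ ≤ _ := by gcongr

/-- If the exceptional clusters are sparse, their points can be moved injectively, over a bounded
distance, to a small part of the remaining clusters. -/
theorem SlowGrowth.exists_absorption (hG : SlowGrowth G) (hfin : FiniteBalls G) {R s : ℕ}
    {c : V → V} (hc : ∀ x, G.edist (c x) x ≤ R) {η : ℝ} (hη : 0 < η) (hη1 : η ≤ 1)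
    (bad : V → Prop) [DecidablePred bad] (hs : 2 * R ≤ s)
    (hbad : ∀ F : Finset V, ((F.filter fun x => bad (c x)).card : ℝ) ≤
      η / 4 * (hfin.nbhd s F).card)
    (T : V → Finset V) (hT : ∀ u, T u ⊆ hfin.cluster R c u)
    (hTcard : ∀ u, η * (hfin.cluster R c u).card ≤ (T u).card) :
    ∃ (Q : ℕ) (g : V → V), (∀ x, G.edist (g x) x ≤ Q) ∧ (∀ x, ¬ bad (c x) → g x = x) ∧
      (∀ x, bad (c x) → ¬ bad (c (g x)) ∧ g x ∈ T (c (g x))) ∧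
      Set.InjOn g {x | bad (c x)} := by
  classical
  obtain ⟨K, hK⟩ := hG.exists_nbhd_doubling hfin s
  -- The reach `K + s` allows `k ≤ K` steps into `X` and then a move of at most `2 * R ≤ s` inside a
  -- cluster.
  let t : {x // bad (c x)} → Finset V := fun a =>
    (hfin.ball (K + s) a).filter fun b => ¬ bad (c b) ∧ b ∈ T (c b)
  have hall : ∀ S : Finset {x // bad (c x)}, S.card ≤ (S.biUnion t).card := by
    intro S
    obtain ⟨F, hF⟩ : ∃ F : Finset V, F = S.map (Function.Embedding.subtype _) := ⟨_, rfl⟩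
    have hFbad : ∀ x ∈ F, bad (c x) := by
      intro x hx
      rw [hF, Finset.mem_map] at hx
      obtain ⟨a, _, rfl⟩ := hx
      exact a.2
    have hFcard : F.card = S.card := by rw [hF, Finset.card_map]
    obtain ⟨k, hkK, hk⟩ := hK F
    -- Hall's condition is checked on `X`: at most `η / 2` of it is bad, so at least half is good,
    -- and the reserved parts of the good clusters meeting it have at least `η / 2 * X.card` points.
    set X := hfin.nbhd k F with hX
    have hFX : F.card ≤ (X.filter fun x => bad (c x)).card :=
      Finset.card_le_card fun x hx =>
        Finset.mem_filter.2 ⟨hfin.mem_nbhd.2 ⟨x, hx, edist_self_le _ _⟩, hFbad x hx⟩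
    have hXbad : ((X.filter fun x => bad (c x)).card : ℝ) ≤ η / 2 * X.card := by
      have h1 : ((hfin.nbhd s X).card : ℝ) ≤ 2 * X.card := by
        exact_mod_cast (Finset.card_le_card (hfin.nbhd_nbhd_subset k s F)).trans hk
      refine (hbad X).trans ?_
      calc η / 4 * ((hfin.nbhd s X).card : ℝ) ≤ η / 4 * (2 * X.card) := by gcongr
        _ = _ := by ring
    set U := (X.image c).filter fun u => ¬ bad u with hU
    have h1 : (X.filter fun x => ¬ bad (c x)).card ≤ ∑ u ∈ U, (hfin.cluster R c u).card := by
      refine (Finset.card_le_card fun x hx => ?_).trans Finset.card_biUnion_le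
      rw [Finset.mem_filter] at hx
      refine Finset.mem_biUnion.2 ⟨c x, ?_, (hfin.mem_cluster hc).2 rfl⟩
      exact Finset.mem_filter.2 ⟨Finset.mem_image_of_mem c hx.1, hx.2⟩
    have h2 : ∑ u ∈ U, (T u).card ≤ (S.biUnion t).card := by
      rw [← hfin.sum_card_cluster T hT U]
      refine Finset.card_le_card fun b hb => ?_
      obtain ⟨u, hu, hbu⟩ := Finset.mem_biUnion.1 hb
      rw [hU, Finset.mem_filter, Finset.mem_image] at hu
      obtain ⟨⟨x, hx, rfl⟩, hgood⟩ := hu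
      have hcb := (hfin.mem_cluster hc).1 (hT _ hbu)
      obtain ⟨z, hz, hzx⟩ := hfin.mem_nbhd.1 hx
      rw [hF, Finset.mem_map] at hz
      obtain ⟨a, ha, rfl⟩ := hz
      refine Finset.mem_biUnion.2 ⟨a, ha, Finset.mem_filter.2 ⟨hfin.mem_ball.2 ?_, ?_, ?_⟩⟩
      · exact edist_le_mono (edist_le_add hzx
          (edist_le_add (edist_le_symm (hc x)) (hcb ▸ hc b))) (by omega)
      · rwa [hcb]
      · rwa [hcb]
    have h3 : ((X.filter fun x => bad (c x)).card : ℝ) + (X.filter fun x => ¬ bad (c x)).card =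
        X.card := by
      exact_mod_cast Finset.card_filter_add_card_filter_not _
    have h4 : η * ∑ u ∈ U, ((hfin.cluster R c u).card : ℝ) ≤ ∑ u ∈ U, ((T u).card : ℝ) := by
      rw [Finset.mul_sum]
      exact Finset.sum_le_sum fun u _ => hTcard u
    have h5 : ((X.filter fun x => ¬ bad (c x)).card : ℝ) ≤
        ∑ u ∈ U, ((hfin.cluster R c u).card : ℝ) := by exact_mod_cast h1
    have h6 : ∑ u ∈ U, ((T u).card : ℝ) ≤ (S.biUnion t).card := by exact_mod_cast h2
    have h7 : (F.card : ℝ) ≤ (X.filter fun x => bad (c x)).card := by exact_mod_cast hFX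
    have h8 : (X.card : ℝ) / 2 ≤ (X.filter fun x => ¬ bad (c x)).card := by
      have : η / 2 * (X.card : ℝ) ≤ 1 / 2 * X.card := by gcongr
      linarith
    have h9 : η * ((X.card : ℝ) / 2) ≤ η * ∑ u ∈ U, ((hfin.cluster R c u).card : ℝ) := by
      gcongr
      exact h8.trans h5
    have h10 : (F.card : ℝ) ≤ (S.biUnion t).card := by linarith
    rw [← hFcard]
    exact_mod_cast h10
  obtain ⟨f, hf, hft⟩ := (Finset.all_card_le_biUnion_card_iff_exists_injective t).1 hall
  have hft' : ∀ a : {x // bad (c x)}, G.edist a (f a) ≤ ((K + s : ℕ) : ℕ∞) ∧ ¬ bad (c (f a)) ∧ f a ∈ T (c (f a)) := by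
    intro a
    simpa only [t, Finset.mem_filter, FiniteBalls.mem_ball] using hft a
  refine ⟨K + s, fun x => if h : bad (c x) then f ⟨x, h⟩ else x, ?_, ?_, ?_, ?_⟩
  · intro x
    by_cases h : bad (c x)
    · simp only [h, dite_true]
      exact edist_le_symm (hft' ⟨x, h⟩).1
    · simp only [h, dite_false]
      exact edist_self_le _ _
  · intro x h
    simp [h]
  · intro x h
    simp only [h, dite_true]
    exact (hft' ⟨x, h⟩).2
  · intro x hx y hy hxy
    have hx' : bad (c x) := hx
    have hy' : bad (c y) := hy
    simp only [hx', hy', dite_true] at hxy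
    exact congrArg Subtype.val (hf hxy)

/-- A graph of slow growth and bounded degree has a partition into Følner sets of bounded
diameter. -/
theorem SlowGrowth.exists_folner_labels (hG : SlowGrowth G) (hfin : FiniteBalls G) {D : ℕ}
    (hD : ∀ x, (hfin.ball 1 x).card ≤ D) {θ : ℝ} (hθ : 0 < θ) :
    ∃ (r : ℕ) (τ : V → V), (∀ x, G.edist (τ x) x ≤ r) ∧
      ∀ u, ((boundaryFinset G (hfin.cluster r τ u)).card : ℝ) ≤
        θ * (hfin.cluster r τ u).card := by
  classical
  obtain ⟨η, hη, hη1, hηθ⟩ : ∃ η : ℝ, 0 < η ∧ η ≤ 1 ∧ 3 * η ≤ θ :=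
    ⟨min 1 (θ / 3), by positivity, min_le_left _ _, by
      have := min_le_right 1 (θ / 3)
      linarith⟩
  -- Boundary vertices then have density at most `η ^ 2 / 4`; Markov loses a factor `η`, leaving the
  -- `η / 4` needed for absorption.
  have hδ : 0 < η ^ 2 / (4 * (D + 1)) := by positivity
  obtain ⟨R, c, O, hc, hO, hOcard, hadj⟩ := hG.exists_ball_carving hfin hδ
  have hbd : ∀ F : Finset V, ((F.filter fun x => ∃ y, G.Adj x y ∧ c x ≠ c y).card : ℝ) ≤
      η ^ 2 / 4 * (hfin.nbhd (2 * R + 1) F).card := by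
    intro F
    refine (hfin.card_filter_boundary_le hD hδ hc hO hOcard hadj F).trans ?_
    gcongr
    rw [mul_div_assoc', div_le_div_iff₀ (by positivity) (by positivity)]
    nlinarith [sq_nonneg η]
  let bad : V → Prop := fun u => η * (hfin.cluster R c u).card <
    (boundaryFinset G (hfin.cluster R c u)).card
  have hbad : ∀ F : Finset V, ((F.filter fun x => bad (c x)).card : ℝ) ≤
      η / 4 * (hfin.nbhd (2 * R + (2 * R + 1)) F).card := by
    intro F
    have h := hfin.card_filter_bad_le hc (by positivity) hη hbd F
    refine le_of_mul_le_mul_left (h.trans (le_of_eq ?_)) hη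
    ring
  have hceil : ∀ u, ⌈η * (hfin.cluster R c u).card⌉₊ ≤ (hfin.cluster R c u).card := by
    intro u
    rw [Nat.ceil_le]
    exact mul_le_of_le_one_left (Nat.cast_nonneg _) hη1
  choose T hT hTcard using fun u => Finset.exists_subset_card_eq (hceil u)
  obtain ⟨Q, g, hgQ, hggood, hgbad, hginj⟩ := hG.exists_absorption hfin hc hη hη1 bad
    (by omega) hbad T hT (fun u => by rw [hTcard]; exact Nat.le_ceil _)
  have hτ : ∀ x, G.edist (c (g x)) x ≤ ((R + Q : ℕ) : ℕ∞) := fun x =>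
    edist_le_add (hc (g x)) (hgQ x)
  refine ⟨R + Q, fun x => c (g x), hτ, fun u => ?_⟩
  set C := hfin.cluster R c u with hC
  set E := hfin.cluster (R + Q) (fun x => c (g x)) u with hE
  have hmemC : ∀ x, x ∈ C ↔ c x = u := fun x => hfin.mem_cluster hc
  have hmemE : ∀ x, x ∈ E ↔ c (g x) = u := fun x => hfin.mem_cluster hτ
  have hEgood : ∀ x ∈ E, ¬ bad u := by
    intro x hx
    rw [hmemE] at hx
    by_cases h : bad (c x)
    · exact hx ▸ (hgbad x h).1
    · rwa [← hx, hggood x h]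
  rcases E.eq_empty_or_nonempty with hemp | ⟨x₀, hx₀⟩
  · simp [hemp, boundaryFinset]
  have hu : ¬ bad u := hEgood x₀ hx₀
  have hCE : C ⊆ E := by
    intro x hx
    rw [hmemC] at hx
    rw [hmemE, hggood x (hx ▸ hu), hx]
  -- The new cluster is `C` with the absorbed points `N`. Its boundary costs `η` for that of `C` and
  -- at most `2 * η` for `N`.
  set N := E.filter fun x => bad (c x) with hN
  have hbdry : boundaryFinset G E ⊆ boundaryFinset G C ∪ N := by
    intro x hx
    obtain ⟨hxE, y, hy, hxy⟩ := mem_boundaryFinset.1 hx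
    rw [Finset.mem_union]
    by_cases h : bad (c x)
    · exact Or.inr (Finset.mem_filter.2 ⟨hxE, h⟩)
    · rw [hmemE, hggood x h] at hxE
      exact Or.inl (mem_boundaryFinset.2 ⟨(hmemC x).2 hxE, y, fun h => hy (hCE h), hxy⟩)
  have hbdryC : ((boundaryFinset G C).card : ℝ) ≤ η * C.card := not_lt.1 hu
  have hcardCE : (C.card : ℝ) ≤ E.card := by exact_mod_cast Finset.card_le_card hCE
  have hNcard : (N.card : ℝ) ≤ 2 * (η * C.card) := by
    rcases N.eq_empty_or_nonempty with hNe | ⟨x, hx⟩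
    · rw [hNe, Finset.card_empty, Nat.cast_zero]
      positivity
    have h1 : N.card ≤ (T u).card := by
      refine Finset.card_le_card_of_injOn g (fun z hz => ?_) fun z hz w hw h => ?_
      · have hz' := Finset.mem_filter.1 (Finset.mem_coe.1 hz)
        have h2 := (hgbad z hz'.2).2
        rwa [(hmemE z).1 hz'.1] at h2
      · exact hginj (Finset.mem_filter.1 (Finset.mem_coe.1 hz)).2
          (Finset.mem_filter.1 (Finset.mem_coe.1 hw)).2 h
    -- This pays for the rounding in `⌈η * C.card⌉₊`: a nonempty boundary gives `1 ≤ η * C.card`.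
    -- With empty boundary, `C` would contain the bad point `x`, which is joined to `g x ∈ C`.
    have h2 : (boundaryFinset G C).Nonempty := by
      by_contra hemp
      obtain ⟨hxE, hxbad⟩ := Finset.mem_filter.1 hx
      have hclosed : ∀ z ∈ (C : Set V), ∀ y, G.Adj z y → y ∈ (C : Set V) := by
        intro z hz y hzy
        by_contra hy
        exact hemp ⟨z, mem_boundaryFinset.2 ⟨hz, y, hy, hzy⟩⟩
      have hgx : g x ∈ (C : Set V) := (hmemC _).2 ((hmemE x).1 hxE)
      have := (hmemC x).1 (mem_of_edist_le hclosed hgx Q x (hgQ x))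
      exact hu (this ▸ hxbad)
    have h3 : (1 : ℝ) ≤ (boundaryFinset G C).card := by exact_mod_cast Finset.card_pos.2 h2
    have h4 : (N.card : ℝ) ≤ (T u).card := by exact_mod_cast h1
    have h5 : ((T u).card : ℝ) < η * C.card + 1 := by
      rw [hTcard]
      exact Nat.ceil_lt_add_one (by positivity)
    linarith
  have hfinal : ((boundaryFinset G E).card : ℝ) ≤ (boundaryFinset G C).card + N.card := by
    exact_mod_cast (Finset.card_le_card hbdry).trans (Finset.card_union_le _ _)
  calc ((boundaryFinset G E).card : ℝ) ≤ 3 * η * C.card := by linarith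
    _ ≤ θ * E.card := by gcongr

end FolnerLabels
end GraphTiling

namespace GraphTiling

/-! ### Random partitions with truncated geometric radii. -/

section RandomPartition

/-- A truncated geometric distribution: almost memoryless, up to the error `(1 - p) ^ R`. -/
theorem exists_truncated_geometric {p : ℝ} (hp : 0 < p) (hp1 : p < 1) (R : ℕ) :
    ∃ q : Fin (R + 1) → ℝ, (∀ i, 0 ≤ q i) ∧ ∑ i, q i = 1 ∧
      ∀ e : ℕ, (∑ i : Fin (R + 1), if (i : ℕ) < e + 2 then q i else 0) -
        (∑ i : Fin (R + 1), if (i : ℕ) < e then q i else 0) ≤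
        2 * p * (1 - ∑ i : Fin (R + 1), if (i : ℕ) < e then q i else 0) + (1 - p) ^ R := by
  -- `S e` is the probability of a value below `e`; the whole tail is put on the value `R`.
  obtain ⟨S, hS⟩ : ∃ S : ℕ → ℝ, S = fun e => if e ≤ R then 1 - (1 - p) ^ e else 1 := ⟨_, rfl⟩
  have hp0 : 0 < 1 - p := by linarith
  have hSle : ∀ e, e ≤ R → S e = 1 - (1 - p) ^ e := fun e he => by rw [hS]; exact if_pos he
  have hSgt : ∀ e, R < e → S e = 1 := fun e he => by rw [hS]; exact if_neg (by omega)
  have hS0 : S 0 = 0 := by rw [hSle 0 (Nat.zero_le _)]; simp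
  have hmono : ∀ k, 0 ≤ S (k + 1) - S k := by
    intro k
    rcases lt_trichotomy k R with h | rfl | h
    · rw [hSle _ h, hSle _ h.le, pow_succ]
      have : 0 < (1 - p) ^ k := by positivity
      nlinarith
    · rw [hSgt _ (Nat.lt_succ_self _), hSle _ le_rfl]
      have : 0 < (1 - p) ^ k := by positivity
      linarith
    · rw [hSgt _ h, hSgt _ (by omega), sub_self]
  have hsum : ∀ n e : ℕ, (∑ i ∈ Finset.range n, if i < e then S (i + 1) - S i else 0) =
      S (min e n) := by
    intro n e
    induction n with
    | zero => simp [hS0]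
    | succ n ih =>
      rw [Finset.sum_range_succ, ih]
      split_ifs with h
      · rw [min_eq_right (by omega), min_eq_right (by omega)]
        ring
      · rw [min_eq_left (by omega), min_eq_left (by omega), add_zero]
  have hcum : ∀ e : ℕ, (∑ i : Fin (R + 1), if (i : ℕ) < e then S (i + 1) - S i else 0) = S e := by
    intro e
    rw [Fin.sum_univ_eq_sum_range (fun i => if i < e then S (i + 1) - S i else 0), hsum]
    rcases le_total e (R + 1) with h | h
    · rw [min_eq_left h]
    · rw [min_eq_right h, hSgt _ (Nat.lt_succ_self _), hSgt e (by omega)]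
  refine ⟨fun i => S (i + 1) - S i, fun i => hmono i, ?_, fun e => ?_⟩
  · rw [Fin.sum_univ_eq_sum_range (fun i => S (i + 1) - S i), Finset.sum_range_sub, hS0,
      hSgt _ (Nat.lt_succ_self _), sub_zero]
  · rw [hcum, hcum]
    have hR : 0 < (1 - p) ^ R := by positivity
    rcases lt_trichotomy e R with h | rfl | h
    · have he : 0 < (1 - p) ^ e := by positivity
      rw [hSle e h.le]
      rcases Nat.lt_or_ge (e + 1) R with h' | h'
      · rw [hSle (e + 2) h', pow_add]
        nlinarith [mul_pos he (mul_pos hp hp)]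
      · have : R = e + 1 := by omega
        rw [hSgt _ (by omega)]
        subst this
        rw [pow_succ] at hR ⊢
        nlinarith [mul_pos hp he]
    · rw [hSle _ le_rfl, hSgt _ (by omega)]
      nlinarith
    · rw [hSgt _ h, hSgt _ (by omega)]
      linarith

open Classical in
/-- Independent almost memoryless variables: the probability that the first one to reach its
threshold overshoots it by less than two is small. -/
theorem sum_prod_first_hit_le {K : ℕ} (q : Fin K → ℝ) (hq0 : ∀ i, 0 ≤ q i) (hq1 : ∑ i, q i = 1)
    {a t : ℝ} (ht : 0 ≤ t)
    (hq : ∀ e : ℕ, (∑ i : Fin K, if (i : ℕ) < e + 2 then q i else 0) -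
      (∑ i : Fin K, if (i : ℕ) < e then q i else 0) ≤
        a * (1 - ∑ i : Fin K, if (i : ℕ) < e then q i else 0) + t) (ha : 0 ≤ a) (M : ℕ) (e : Fin M → ℕ) :
    (∑ ω : Fin M → Fin K, if ∃ i, (∀ j < i, (ω j : ℕ) < e j) ∧ e i ≤ ω i ∧ (ω i : ℕ) < e i + 2
      then ∏ i, q (ω i) else 0) ≤ a + t * M := by
  induction M with
  | zero => simpa using ha
  | succ M ih =>
    have hprod : ∑ ω : Fin M → Fin K, ∏ i, q (ω i) = 1 := by
      have h := Finset.prod_univ_sum (fun _ : Fin M => (Finset.univ : Finset (Fin K)))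
        (fun _ j => q j)
      rw [Fintype.piFinset_univ] at h
      rw [← h]
      simp [hq1]
    have hbad : ∀ (k : Fin K) (ω : Fin M → Fin K),
        (∃ i, (∀ j < i, ((Fin.cons k ω : Fin (M + 1) → Fin K) j : ℕ) < e j) ∧
          e i ≤ (Fin.cons k ω : Fin (M + 1) → Fin K) i ∧
          ((Fin.cons k ω : Fin (M + 1) → Fin K) i : ℕ) < e i + 2) ↔
        (e 0 ≤ k ∧ (k : ℕ) < e 0 + 2) ∨ ((k : ℕ) < e 0 ∧
          ∃ i, (∀ j < i, (ω j : ℕ) < e j.succ) ∧ e i.succ ≤ ω i ∧ (ω i : ℕ) < e i.succ + 2) := by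
      intro k ω
      simp only [Fin.exists_fin_succ, Fin.forall_fin_succ, Fin.cons_zero, Fin.cons_succ,
        Fin.succ_lt_succ_iff, Fin.succ_pos, not_lt_zero, forall_true_left,
        false_imp_iff, implies_true, true_and, and_assoc, exists_and_left]
    set B : ℝ := ∑ ω : Fin M → Fin K,
      if ∃ i, (∀ j < i, (ω j : ℕ) < e j.succ) ∧ e i.succ ≤ ω i ∧ (ω i : ℕ) < e i.succ + 2
      then ∏ i, q (ω i) else 0 with hB
    have hBle : B ≤ a + t * M := ih fun i => e i.succ
    have hsplit : (∑ ω : Fin (M + 1) → Fin K,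
        if ∃ i, (∀ j < i, (ω j : ℕ) < e j) ∧ e i ≤ ω i ∧ (ω i : ℕ) < e i + 2
        then ∏ i, q (ω i) else 0) =
        ∑ k : Fin K, ((if (k : ℕ) < e 0 + 2 then q k else 0) - (if (k : ℕ) < e 0 then q k else 0) +
          (if (k : ℕ) < e 0 then q k else 0) * B) := by
      rw [← (Fin.consEquiv fun _ : Fin (M + 1) => Fin K).sum_comp, Fintype.sum_prod_type]
      refine Finset.sum_congr rfl fun k _ => ?_
      simp only [Fin.consEquiv_apply, hbad, Fin.prod_univ_succ, Fin.cons_zero, Fin.cons_succ]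
      rcases lt_or_ge (k : ℕ) (e 0) with h | h
      · have h1 : (k : ℕ) < e 0 + 2 := by omega
        simp only [h, h1, not_le.2 h, false_and, false_or, true_and, if_true, sub_self, zero_add,
          hB, Finset.mul_sum, mul_ite, mul_zero]
      · by_cases h1 : (k : ℕ) < e 0 + 2
        · simp only [h, h1, not_lt.2 h, false_and, or_false, true_and, if_true, if_false,
            ← Finset.mul_sum, hprod]
          ring
        · simp [h1, not_lt.2 h]
    rw [hsplit, Finset.sum_add_distrib, Finset.sum_sub_distrib, ← Finset.sum_mul]
    have h := hq (e 0)
    set Q : ℝ := ∑ k : Fin K, if (k : ℕ) < e 0 then q k else 0 with hQ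
    have hQ0 : 0 ≤ Q := Finset.sum_nonneg fun k _ => by
      split_ifs
      exacts [hq0 k, le_rfl]
    have hQ1 : Q ≤ 1 := by
      rw [← hq1]
      refine Finset.sum_le_sum fun k _ => ?_
      split_ifs
      exacts [le_rfl, hq0 k]
    -- Conditioning on the first coordinate bounds the total by `a * (1 - Q) + t + Q * (a + t * M)`,
    -- where the terms in `a` combine to `a`.
    have h1 : Q * B ≤ Q * (a + t * M) := by gcongr
    have h2 : Q * (t * M) ≤ 1 * (t * M) := by gcongr
    push_cast
    nlinarith

variable {V : Type*} {H : SimpleGraph V}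

/-- Greedy colouring: vertices at distance at most `r` get different colours. -/
theorem FiniteBalls.exists_coloring (hfin : FiniteBalls H) {r M : ℕ}
    (hM : ∀ x, (graphBall H r x).ncard ≤ M) :
    ∃ col : V → Fin M, ∀ u v, H.edist u v ≤ r → col u = col v → u = v := by
  classical
  let lt : V → V → Prop := WellOrderingRel
  have hwf : WellFounded lt := IsWellFounded.wf
  obtain ⟨col, hcol⟩ := exists_forall_of_wellFounded hwf
    (fun v (f : ∀ u, lt u v → Fin M) (a : Fin M) => ∀ u (h : lt u v), H.edist u v ≤ r → f u h ≠ a)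
    (by
      intro v f
      by_contra! hcon
      choose u hu hur hfu using hcon
      have hinj : Function.Injective u := by
        intro a b hab
        rw [← hfu a, ← hfu b]
        simp only [hab]
      have h1 : (Finset.univ : Finset (Fin M)).card ≤ ((hfin.ball r v).erase v).card := by
        refine Finset.card_le_card_of_injOn u (fun a _ => ?_) hinj.injOn
        rw [Finset.mem_coe, Finset.mem_erase]
        refine ⟨fun h => ?_, hfin.mem_ball.2 (edist_le_symm (hur a))⟩
        have h' : lt v v := h ▸ hu a
        exact hwf.irrefl.irrefl v h'
      rw [Finset.card_univ, Fintype.card_fin,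
        Finset.card_erase_of_mem (hfin.mem_ball.2 (edist_self_le v r)), hfin.card_ball] at h1
      have h2 := hM v
      have h3 := hfin.ncard_pos r v
      omega)
  refine ⟨col, fun u v huv h => ?_⟩
  rcases trichotomous_of WellOrderingRel u v with h1 | h1 | h1
  · exact absurd h (hcol v u h1 huv)
  · exact h1
  · exact absurd h.symm (hcol u v h1 (edist_le_symm huv))

open Classical in
/-- A graph of slow growth has a random partition into sets of bounded diameter, with finitely many
outcomes, for which every vertex is unlikely to have a neighbour in a different set. -/
theorem SlowGrowth.exists_random_partition (hG : SlowGrowth H) (hfin : FiniteBalls H) {a : ℝ}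
    (ha : 0 < a) :
    ∃ (R M : ℕ) (w : (Fin M → Fin (R + 1)) → ℝ) (c : (Fin M → Fin (R + 1)) → V → V),
      (∀ ω, 0 ≤ w ω) ∧ ∑ ω, w ω = 1 ∧ (∀ ω x, H.edist (c ω x) x ≤ R) ∧
      ∀ x, (∑ ω, if ∃ y, H.Adj x y ∧ c ω x ≠ c ω y then w ω else 0) < a := by
  obtain ⟨p, hp, hp1, hpa⟩ : ∃ p : ℝ, 0 < p ∧ p ≤ 1 / 2 ∧ 2 * p ≤ a / 4 :=
    ⟨min (1 / 2) (a / 8), by positivity, min_le_left _ _, by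
      have := min_le_right (1 / 2) (a / 8)
      linarith⟩
  obtain ⟨N, hN⟩ := hG (1 + p / 8) (by linarith)
  obtain ⟨n, hn⟩ := exists_pow_lt_of_lt_one (show 0 < a / 4 by linarith)
    (show 1 - p / 2 < 1 by linarith)
  obtain ⟨R, hRN, hRn⟩ : ∃ R, N ≤ R ∧ n ≤ R := ⟨max N n, le_max_left _ _, le_max_right _ _⟩
  have hRa : (1 - p / 2) ^ R < a / 4 :=
    (pow_le_pow_of_le_one (by linarith) (by linarith) hRn).trans_lt hn
  -- The number of colours grows in `R` much more slowly than `(1 - p) ^ R` decays, so the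
  -- truncation errors over all colours stay below `a / 4`.
  obtain ⟨M, hM⟩ : ∃ M, M = ⌊(1 + p / 8) ^ (2 * R)⌋₊ := ⟨_, rfl⟩
  have hMball : ∀ x, (graphBall H (2 * R) x).ncard ≤ M := fun x => by
    rw [hM]
    exact Nat.le_floor (hN (2 * R) (by omega) x)
  have hMt : (1 - p) ^ R * M ≤ a / 4 := by
    have h1 : (M : ℝ) ≤ (1 + p / 8) ^ (2 * R) := by
      rw [hM]
      exact Nat.floor_le (by positivity)
    have h0 : 0 ≤ 1 - p := by linarith
    calc (1 - p) ^ R * M ≤ (1 - p) ^ R * (1 + p / 8) ^ (2 * R) := by gcongr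
      _ = ((1 - p) * (1 + p / 8) ^ 2) ^ R := by rw [pow_mul, mul_pow]
      _ ≤ (1 - p / 2) ^ R := by
        gcongr
        nlinarith [mul_pos hp hp, mul_pos hp (mul_pos hp hp)]
      _ ≤ a / 4 := hRa.le
  obtain ⟨col, hcol⟩ := hfin.exists_coloring hMball
  obtain ⟨q, hq0, hq1, hq⟩ := exists_truncated_geometric hp (by linarith : p < 1) R
  -- All centres of a colour share one radius; a point joins a covering centre of least colour. Two
  -- such centres are within `2 * R`, so the colouring makes the choice unique.
  have hc : ∀ (ω : Fin M → Fin (R + 1)) (x : V), ∃ v,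
      H.edist v x ≤ ((ω (col v) : ℕ) : ℕ∞) ∧
        ∀ u, H.edist u x ≤ ((ω (col u) : ℕ) : ℕ∞) → col v ≤ col u := by
    intro ω x
    obtain ⟨i, ⟨v, hv, rfl⟩, hi⟩ := (wellFounded_lt (α := Fin M)).has_min
      (col '' {v | H.edist v x ≤ ((ω (col v) : ℕ) : ℕ∞)}) ⟨col x, x, edist_self_le _ _, rfl⟩
    exact ⟨v, hv, fun u hu => not_lt.1 (hi _ ⟨u, hu, rfl⟩)⟩
  choose c hc1 hc2 using hc
  have hωR : ∀ (ω : Fin M → Fin (R + 1)) i, (ω i : ℕ) ≤ R := fun ω i => Nat.lt_succ_iff.1 (ω i).2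
  refine ⟨R, M, fun ω => ∏ i, q (ω i), c, fun ω => Finset.prod_nonneg fun i _ => hq0 _, ?_,
    fun ω x => edist_le_mono (hc1 ω x) (hωR ω _), fun x => ?_⟩
  · have h := Finset.prod_univ_sum (fun _ : Fin M => (Finset.univ : Finset (Fin (R + 1))))
      (fun _ j => q j)
    rw [Fintype.piFinset_univ] at h
    rw [← h]
    simp [hq1]
  -- Below the threshold `e`, no ball of colour `i` meets the unit ball of `x`. Without such centres
  -- the value is `R + 1`, which no radius reaches.
  have he : ∀ i : Fin M, ∃ e : ℕ,
      (∀ v, col v = i → ∀ k ≤ R, H.edist v x ≤ ((k + 1 : ℕ) : ℕ∞) → e ≤ k) ∧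
      (e ≤ R → ∃ v, col v = i ∧ H.edist v x ≤ ((e + 1 : ℕ) : ℕ∞)) := by
    intro i
    by_cases h : ∃ k : ℕ, ∃ v, col v = i ∧ H.edist v x ≤ ((k + 1 : ℕ) : ℕ∞)
    · exact ⟨Nat.find h, fun v hv k _ hk => Nat.find_min' h ⟨v, hv, hk⟩, fun _ => Nat.find_spec h⟩
    · exact ⟨R + 1, fun v hv k _ hk => absurd ⟨k, v, hv, hk⟩ h, fun h => by omega⟩
  choose e he1 he2 using he
  have hgood : ∀ ω : Fin M → Fin (R + 1),
      (¬ ∃ i, (∀ j < i, (ω j : ℕ) < e j) ∧ e i ≤ ω i ∧ (ω i : ℕ) < e i + 2) →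
      ¬ ∃ y, H.Adj x y ∧ c ω x ≠ c ω y := by
    -- For the first colour reaching its threshold, a centre `v` is within `e i + 1` of `x`; an
    -- overshoot by two makes its ball contain the whole unit ball of `x`, which then goes to `v`.
    rintro ω hω ⟨y, hxy, hne⟩
    obtain ⟨i, hi, hmin⟩ := (wellFounded_lt (α := Fin M)).has_min {i | e i ≤ ω i}
      ⟨col x, (he1 _ x rfl 0 (Nat.zero_le _) (edist_self_le _ _)).trans (Nat.zero_le _)⟩
    have hi' : e i ≤ ω i := hi
    have hlow : ∀ j < i, (ω j : ℕ) < e j := fun j hj => not_le.1 fun h => hmin j h hj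
    have hei : e i + 2 ≤ ω i := by
      by_contra h
      exact hω ⟨i, hlow, hi, by omega⟩
    obtain ⟨v, rfl, hvx⟩ := he2 i (hi'.trans (hωR ω i))
    have key : ∀ z, H.edist x z ≤ (1 : ℕ) → c ω z = v := by
      intro z hz
      have hvz : H.edist v z ≤ ((ω (col v) : ℕ) : ℕ∞) :=
        edist_le_mono (edist_le_add hvx hz) (by omega)
      have hle := hc2 ω z v hvz
      have heq : col (c ω z) = col v := by
        refine le_antisymm hle (not_lt.1 fun hlt => ?_)
        have h1 := hlow _ hlt
        have h2 := he1 _ (c ω z) rfl (ω (col (c ω z))) (hωR ω _)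
          (edist_le_add (hc1 ω z) (edist_le_symm hz))
        omega
      refine hcol _ _ (edist_le_mono (edist_le_add (hc1 ω z) (edist_le_symm hvz)) ?_) heq
      have := hωR ω (col v)
      rw [heq]
      omega
    exact hne ((key x (edist_self_le _ _)).trans (key y (edist_le_one_of_adj hxy)).symm)
  have hmain := sum_prod_first_hit_le q hq0 hq1 (pow_nonneg (by linarith) R) hq (by linarith) M e
  refine lt_of_le_of_lt ?_ (show 2 * p + (1 - p) ^ R * M < a by linarith)
  refine le_trans (Finset.sum_le_sum fun ω _ => ?_) hmain
  have hnn : 0 ≤ ∏ i, q (ω i) := Finset.prod_nonneg fun i _ => hq0 _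
  by_cases h : ∃ i, (∀ j < i, (ω j : ℕ) < e j) ∧ e i ≤ ω i ∧ (ω i : ℕ) < e i + 2
  · rw [if_pos h]
    split_ifs
    exacts [le_rfl, hnn]
  · rw [if_neg h, if_neg (hgood ω h)]

end RandomPartition
end GraphTiling

namespace GraphTiling

/-! ### Contraction to the label graph, measures on packings, and assembly. -/

section Quotient

variable {V : Type*} {G : SimpleGraph V}

/-- The graph on labels in which two labels are adjacent if some edge of `G` joins them. -/
def labelGraph (G : SimpleGraph V) (τ : V → V) : SimpleGraph V :=
  SimpleGraph.fromRel fun u v => ∃ x y, τ x = u ∧ τ y = v ∧ G.Adj x y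

theorem labelGraph_adj {τ : V → V} {x y : V} (h : G.Adj x y) (hne : τ x ≠ τ y) :
    (labelGraph G τ).Adj (τ x) (τ y) :=
  (SimpleGraph.fromRel_adj _ _ _).2 ⟨hne, Or.inl ⟨x, y, rfl, rfl, h⟩⟩

theorem edist_le_of_labelGraph_adj {τ : V → V} {r : ℕ} (hτ : ∀ x, G.edist (τ x) x ≤ r) (u v : V)
    (h : (labelGraph G τ).Adj u v) : G.edist u v ≤ ((2 * r + 1 : ℕ) : ℕ∞) := by
  have key : ∀ x y, G.Adj x y → G.edist (τ x) (τ y) ≤ ((2 * r + 1 : ℕ) : ℕ∞) := fun x y hxy =>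
    edist_le_mono (edist_le_add (hτ x)
      (edist_le_add (edist_le_one_of_adj hxy) (edist_le_symm (hτ y)))) (by omega)
  obtain ⟨_, ⟨x, y, rfl, rfl, hxy⟩ | ⟨x, y, rfl, rfl, hxy⟩⟩ := (SimpleGraph.fromRel_adj _ _ _).1 h
  · exact key x y hxy
  · exact edist_le_symm (key x y hxy)

theorem FiniteBalls.of_edist_le_mul {H : SimpleGraph V} (hfin : FiniteBalls G) {L : ℕ}
    (hL : ∀ x y, H.Adj x y → G.edist x y ≤ L) : FiniteBalls H := fun r x =>
  (hfin (L * r) x).subset fun y hy => edist_le_mul_of_adj hL r x y hy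

/-- Balls of radius `r` in `H` lie in balls of radius `L * r` in `G`, so the base `b ^ (1 / L)` for
`G` yields `b` for `H`. -/
theorem SlowGrowth.of_edist_le_mul {H : SimpleGraph V} (hG : SlowGrowth G) (hfin : FiniteBalls G)
    {L : ℕ} (hL0 : 0 < L) (hL : ∀ x y, H.Adj x y → G.edist x y ≤ L) : SlowGrowth H := by
  intro b hb
  obtain ⟨N, hN⟩ := hG (b ^ ((1 : ℝ) / L)) (Real.one_lt_rpow hb (by positivity))
  refine ⟨N, fun r hr x => ?_⟩
  have h1 : (graphBall H r x).ncard ≤ (graphBall G (L * r) x).ncard :=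
    Set.ncard_le_ncard (fun y hy => edist_le_mul_of_adj hL r x y hy) (hfin _ _)
  have h2 := hN (L * r) (hr.le.trans (Nat.le_mul_of_pos_left r hL0)) x
  rw [pow_mul, ← Real.rpow_natCast _ L, ← Real.rpow_mul (by linarith),
    one_div_mul_cancel (by positivity), Real.rpow_one] at h2
  exact (Nat.cast_le.2 h1).trans h2

/-- A set that is a union of clusters with small boundary has small boundary. -/
theorem FiniteBalls.card_boundaryFinset_union_le (hfin : FiniteBalls G) {r : ℕ} {τ : V → V}
    (hτ : ∀ x, G.edist (τ x) x ≤ r) {θ : ℝ} (hθ : 0 ≤ θ)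
    (hfol : ∀ u, ((boundaryFinset G (hfin.cluster r τ u)).card : ℝ) ≤
      θ * (hfin.cluster r τ u).card) (F : Finset V)
    (hF : ∀ x ∈ F, ∀ y, τ y = τ x → y ∈ F) :
    ((boundaryFinset G F).card : ℝ) ≤ θ * F.card := by
  classical
  have h1 : (boundaryFinset G F).card ≤
      ∑ u ∈ F.image τ, (boundaryFinset G (hfin.cluster r τ u)).card := by
    refine (Finset.card_le_card fun x hx => ?_).trans Finset.card_biUnion_le
    obtain ⟨hxF, y, hy, hxy⟩ := mem_boundaryFinset.1 hx
    refine Finset.mem_biUnion.2 ⟨τ x, Finset.mem_image_of_mem _ hxF, mem_boundaryFinset.2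
      ⟨(hfin.mem_cluster hτ).2 rfl, y, fun h => hy ?_, hxy⟩⟩
    exact hF x hxF y ((hfin.mem_cluster hτ).1 h)
  have h2 : ∑ u ∈ F.image τ, (hfin.cluster r τ u).card ≤ F.card := by
    rw [← hfin.sum_card_cluster _ (fun u => subset_rfl) (F.image τ)]
    refine Finset.card_le_card fun y hy => ?_
    obtain ⟨u, hu, hyu⟩ := Finset.mem_biUnion.1 hy
    obtain ⟨x, hx, rfl⟩ := Finset.mem_image.1 hu
    exact hF x hx y ((hfin.mem_cluster hτ).1 hyu)
  calc ((boundaryFinset G F).card : ℝ)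
      ≤ ∑ u ∈ F.image τ, ((boundaryFinset G (hfin.cluster r τ u)).card : ℝ) := by
        exact_mod_cast h1
    _ ≤ ∑ u ∈ F.image τ, θ * ((hfin.cluster r τ u).card : ℝ) :=
        Finset.sum_le_sum fun u _ => hfol u
    _ = θ * ∑ u ∈ F.image τ, ((hfin.cluster r τ u).card : ℝ) := (Finset.mul_sum _ _ _).symm
    _ ≤ θ * F.card := by
        gcongr
        exact_mod_cast h2

end Quotient

namespace FolnerPacking

variable {V : Type*} {G : SimpleGraph V} {ε : ℝ} {r : ℕ}

theorem code_injective : Function.Injective (code : FolnerPacking G ε r → Finset V → Bool) := by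
  rintro ⟨t, _, _, _⟩ ⟨t', _, _, _⟩ h
  have : t = t' := by
    ext F
    simpa [code] using congrFun h F
  subst this
  rfl

/-- Hausdorff and Borel make singletons measurable, so Dirac masses can be evaluated on arbitrary
sets of packings. -/
instance : T2Space (FolnerPacking G ε r) :=
  T2Space.of_injective_continuous code_injective continuous_induced_dom

instance : BorelSpace (FolnerPacking G ε r) :=
  ⟨rfl⟩

/-- The packing whose members are the nonempty clusters of a labelling. -/
def ofLabels (hfin : FiniteBalls G) {R : ℕ} (f : V → V) (hf : ∀ x, G.edist (f x) x ≤ R)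
    (hr : R + R ≤ r) (hfol : ∀ u, (hfin.cluster R f u).Nonempty →
      IsFolnerSet G ε (hfin.cluster R f u)) : FolnerPacking G ε r where
  tiles := {F | ∃ u, F = hfin.cluster R f u ∧ F.Nonempty}
  folner := by
    rintro F ⟨u, rfl, h⟩
    exact hfol u h
  diam_le := by
    rintro F ⟨u, rfl, -⟩ x hx y hy
    rw [hfin.mem_cluster hf] at hx hy
    exact edist_le_mono (edist_le_add (edist_le_symm (hx ▸ hf x)) (hy ▸ hf y)) hr
  disjoint := by
    rintro F ⟨u, rfl, -⟩ F' ⟨v, rfl, -⟩ hne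
    refine Finset.disjoint_left.2 fun x hx hx' => hne ?_
    rw [hfin.mem_cluster hf] at hx hx'
    rw [← hx, ← hx']

variable {hfin : FiniteBalls G} {R : ℕ} {f : V → V} {hf : ∀ x, G.edist (f x) x ≤ R}
  {hr : R + R ≤ r} {hfol : ∀ u, (hfin.cluster R f u).Nonempty →
    IsFolnerSet G ε (hfin.cluster R f u)}

theorem isTiling_ofLabels : (ofLabels hfin f hf hr hfol).IsTiling := fun x =>
  have hx := (hfin.mem_cluster hf).2 rfl
  ⟨hfin.cluster R f (f x), ⟨f x, rfl, x, hx⟩, hx⟩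

theorem exists_adj_ne_of_mem_innerBoundary {F : Finset V} {x : V}
    (hF : F ∈ (ofLabels hfin f hf hr hfol).tiles) (hx : x ∈ innerBoundary G F) :
    ∃ y, G.Adj x y ∧ f x ≠ f y := by
  obtain ⟨u, rfl, -⟩ := hF
  obtain ⟨hxF, y, hy, hxy⟩ := hx
  rw [hfin.mem_cluster hf] at hxF hy
  exact ⟨y, hxy, fun h => hy (h ▸ hxF)⟩

open Classical in
/-- A random tiling with finitely many outcomes gives a Borel measure on packings. -/
theorem exists_measure {Ω : Type*} [Fintype Ω] (w : Ω → ℝ) (hw : ∀ ω, 0 ≤ w ω)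
    (hw1 : ∑ ω, w ω = 1) (P : Ω → FolnerPacking G ε r) (hP : ∀ ω, (P ω).IsTiling) :
    ∃ ν : Measure (FolnerPacking G ε r), IsProbabilityMeasure ν ∧ (∀ᵐ Q ∂ν, Q.IsTiling) ∧
      ∀ S : Set (FolnerPacking G ε r), ν S = ENNReal.ofReal (∑ ω, if P ω ∈ S then w ω else 0) := by
  obtain ⟨ν, hν⟩ : ∃ ν : Measure (FolnerPacking G ε r),
      ν = ∑ ω, ENNReal.ofReal (w ω) • Measure.dirac (P ω) := ⟨_, rfl⟩
  have hS : ∀ S : Set (FolnerPacking G ε r),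
      ν S = ENNReal.ofReal (∑ ω, if P ω ∈ S then w ω else 0) := by
    intro S
    rw [hν, Measure.finsetSum_apply, ENNReal.ofReal_sum_of_nonneg]
    · refine Finset.sum_congr rfl fun ω _ => ?_
      rw [Measure.smul_apply, Measure.dirac_apply, smul_eq_mul, Set.indicator_apply]
      split_ifs <;> simp
    · intro ω _
      split_ifs
      exacts [hw ω, le_rfl]
  refine ⟨ν, ⟨?_⟩, ?_, hS⟩
  · rw [hS]
    simp [hw1]
  · rw [ae_iff, hS]
    simp [hP]

end FolnerPacking

theorem SlowGrowth.stronglyAlmostFinite {V : Type*} {G : SimpleGraph V} (hG : SlowGrowth G)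
    (hfin : FiniteBalls G) {D : ℕ} (hD : ∀ x, (hfin.ball 1 x).card ≤ D) :
    StronglyAlmostFinite G := by
  classical
  intro ε hε
  obtain ⟨r, τ, hτ, hfol⟩ := hG.exists_folner_labels hfin hD (half_pos hε)
  have hadj := edist_le_of_labelGraph_adj (G := G) hτ
  obtain ⟨R, M, w, c, hw, hw1, hc, hprob⟩ :=
    (hG.of_edist_le_mul hfin (Nat.succ_pos _) hadj).exists_random_partition
      (hfin.of_edist_le_mul hadj) hε
  obtain ⟨K, hK⟩ : ∃ K, K = (2 * r + 1) * R + r := ⟨_, rfl⟩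
  have hf : ∀ ω x, G.edist (c ω (τ x)) x ≤ K := fun ω x => by
    rw [hK]
    exact edist_le_add (edist_le_mul_of_adj hadj R _ _ (hc ω (τ x))) (hτ x)
  have hfolner : ∀ ω u, (hfin.cluster K (fun x => c ω (τ x)) u).Nonempty →
      IsFolnerSet G ε (hfin.cluster K (fun x => c ω (τ x)) u) := by
    intro ω u hne
    refine ⟨hne, ?_⟩
    have hpos : (0 : ℝ) < (hfin.cluster K (fun x => c ω (τ x)) u).card := by
      exact_mod_cast Finset.card_pos.2 hne
    rw [ncard_innerBoundary, div_lt_iff₀ hpos]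
    -- Tiles are unions of `τ`-clusters with ratio at most `ε / 2`; the halving gives the strict
    -- inequality.
    refine (hfin.card_boundaryFinset_union_le hτ (half_pos hε).le hfol _
      fun x hx y hxy => ?_).trans_lt (by nlinarith)
    rw [hfin.mem_cluster (hf ω)] at hx ⊢
    rw [hxy, hx]
  obtain ⟨ν, hν, htil, hνS⟩ := FolnerPacking.exists_measure w hw hw1
    (fun ω => FolnerPacking.ofLabels (r := K + K + 1) hfin _ (hf ω) (Nat.le_succ _) (hfolner ω))
    (fun ω => FolnerPacking.isTiling_ofLabels)
  refine ⟨K + K + 1, Nat.succ_le_succ (Nat.zero_le _), ν, hν, htil, fun x => ?_⟩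
  rw [hνS, ENNReal.ofReal_lt_ofReal_iff hε]
  -- An edge leaving the tile of `x` joins different labels, hence is an edge of the label graph at
  -- `τ x` between two random parts.
  refine (Finset.sum_le_sum fun ω _ => ?_).trans_lt (hprob (τ x))
  by_cases h : ∃ y, (labelGraph G τ).Adj (τ x) y ∧ c ω (τ x) ≠ c ω y
  · rw [if_pos h]
    split_ifs
    exacts [le_rfl, hw ω]
  · rw [if_neg h, if_neg]
    rintro ⟨-, F, hF, hxF⟩
    obtain ⟨y, hxy, hne⟩ := FolnerPacking.exists_adj_ne_of_mem_innerBoundary hF hxF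
    exact h ⟨τ y, labelGraph_adj hxy fun he => hne (congrArg (c ω) he), hne⟩

end GraphTiling

theorem mainTheorem7 {V : Type*} [Countable V] (G : SimpleGraph V) (d : ℕ)
    (hd : GraphTiling.DegreeBoundedBy G d) (hG : GraphTiling.SubexponentialGrowth G) :
    GraphTiling.StronglyAlmostFinite G := by
  refine (hG.slowGrowth hd).stronglyAlmostFinite hd.finiteBalls (D := (d + 1) ^ 1) fun x => ?_
  rw [GraphTiling.FiniteBalls.card_ball]
  exact hd.ncard_graphBall_le 1 x
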